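/- Let $k\ge 1$ be an integer. In the $k$-semi-random graph process on the vertex set $[n]$ one starts with the empty graph $G_0$; in each round $t\ge 1$, vertices $u_t^1,\dots,u_t^k$ are drawn independently and uniformly at random from $[n]$ (repetitions allowed), and the player selects an index $i_t\in[k]$ and a vertex $v_t\in[n]$ and adds the edge $u_tv_t$, where $u_t=u_t^{i_t}$, to form the multigraph $G_t$ (loops and parallel edges are allowed). A strategy $\mathcal S$ specifies, for each $t$, a distribution over $[k]\times[n]$ for the choice of $(i_t,v_t)$ as a function of $u_1,v_1,\dots,u_{t-1},v_{t-1},u_t^1,\dots,u_t^k$. For $0<q<1$ let $\hat\tau(\mathcal S,q,n,k)$ be the minimum $t\ge 0$ such that, following $\mathcal S$, the multigraph $G_t$ has a perfect matching with probability at least $q$ (and $\infty$ if there is no such $t$), let $\hat\tau(q,n,k)=\inf_{\mathcal S}\hat\tau(\mathcal S,q,n,k)$, and let $$\tau_{\mathtt{PM}}(k)=\lim_{q\to1^-}\ \limsup_{\substack{n\to\infty\\ n\text{ even}}}\ \frac{\hat\tau(q,n,k)}{n}\in[0,\infty];$$ the limit exists because the upper limit is non-decreasing in $q$. Theorem. For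 every integer $k\ge1$ we have $\tau_{\mathtt{PM}}(k)\ge\frac12$. Moreover, there is an absolute constant $C>0$ such that for every integer $k\ge2$ $$\tau_{\mathtt{PM}}(k)\le\frac12\left(1+C\sqrt{\frac{\log k}{k}}\right),$$ where $\log$ is the natural logarithm. In particular, $\tau_{\mathtt{PM}}(k)\to\frac12$ as $k\to\infty$. -/

import Mathlib

open Filter Topology
open scoped ENNReal

noncomputable section

namespace SemiRandom

/-- A (multi)graph on the vertex set `V`, given by its multiset of edges; loops and parallel
edges are allowed. -/
abbrev Multigraph (V : Type) : Type := Multiset (Sym2 V)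

/-- The (multi)graph has a perfect matching. Loops and multiplicities play no role for matchings,
so this is the existence of a perfect matching of the underlying simple graph
(`SimpleGraph.fromEdgeSet` discards the loops). -/
def HasPerfectMatching {V : Type} (G : Multigraph V) : Prop :=
  ∃ M : (SimpleGraph.fromEdgeSet {e : Sym2 V | e ∈ G}).Subgraph, M.IsPerfectMatching

/-- The history `(u₁, v₁), …, (uₜ, vₜ)` of a game: the pairs (chosen square, circle) of the
rounds played so far, the most recent round first. Its length is the number `t` of rounds. -/
abbrev History (V : Type) : Type := List (V × V)

/-- The multigraph built after a given history: one edge `uᵢvᵢ` for each round. -/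
def History.graph {V : Type} (h : History V) : Multigraph V :=
  Multiset.ofList (h.map fun e => s(e.1, e.2))

/-- A (possibly randomized) strategy against the `k`-process on the vertex set `V`: for each
history and each `k`-tuple of offered squares, a distribution on pairs
(index of the chosen square, vertex receiving the circle). -/
abbrev Strategy (k : ℕ) (V : Type) : Type := History V → (Fin k → V) → PMF (Fin k × V)

/-- The law of the history after `t` rounds of the `k`-process played with the strategy `S`.
In each round the tuple of squares is uniform on `V ^ k`, that is, the `k` squares are
independent and uniform on `V`, and independent of the past. -/
def historyLaw {k : ℕ} {V : Type} [Fintype V] [Nonempty V] (S : Strategy k V) :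
    ℕ → PMF (History V)
  | 0 => PMF.pure []
  | t + 1 => (historyLaw S t).bind fun h =>
      (PMF.uniformOfFintype (Fin k → V)).bind fun squares =>
        (S h squares).map fun choice => (squares choice.1, choice.2) :: h

/-- The law of the random multigraph `G_t` obtained by following `S` for `t` rounds. -/
def graphLaw {k : ℕ} {V : Type} [Fintype V] [Nonempty V] (S : Strategy k V) (t : ℕ) :
    PMF (Multigraph V) :=
  (historyLaw S t).map History.graph

/-- The least `t` such that `G_t` has property `P` with probability at least `q`, when
following `S`; it is `⊤` if there is no such `t`. -/
def hitTime {k : ℕ} {V : Type} [Fintype V] [Nonempty V] (P : Multigraph V → Prop)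
    (S : Strategy k V) (q : ℝ) : ℕ∞ :=
  ⨅ (t : ℕ) (_ : ENNReal.ofReal q ≤ (graphLaw S t).toOuterMeasure {G | P G}), (t : ℕ∞)

/-- The infimum of `hitTime` over all strategies. -/
def optTime {V : Type} [Fintype V] [Nonempty V] (P : Multigraph V → Prop) (q : ℝ) (k : ℕ) : ℕ∞ :=
  ⨅ S : Strategy k V, hitTime P S q

/-- `limsup` of the normalized optimal times `τ̂(q, n, k) / n` as `n → ∞` along the filter `F`. -/
def limsupTime (F : Filter ℕ+) (P : ∀ n : ℕ+, Multigraph (Fin n) → Prop) (k : ℕ) (q : ℝ) : ℝ≥0∞ :=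
  limsup (fun n : ℕ+ => (optTime (P n) q k : ℝ≥0∞) / ((n : ℕ) : ℝ≥0∞)) F

/-- The threshold of the property `P` in the `k`-process, `n → ∞` along `F`: the limit of
`limsupTime` as `q → 1⁻`, which exists by `tendsto_limsupTime`. -/
def threshold (F : Filter ℕ+) (P : ∀ n : ℕ+, Multigraph (Fin n) → Prop) (k : ℕ) : ℝ≥0∞ :=
  limUnder (𝓝[<] (1 : ℝ)) (limsupTime F P k)

theorem optTime_mono {V : Type} [Fintype V] [Nonempty V] (P : Multigraph V → Prop) (k : ℕ) :
    Monotone fun q : ℝ => optTime P q k := fun _ _ h =>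
  iInf_mono fun _ => iInf_mono fun _ =>
    iInf_mono' fun h' => ⟨(ENNReal.ofReal_le_ofReal h).trans h', le_rfl⟩

theorem limsupTime_mono (F : Filter ℕ+) (P : ∀ n : ℕ+, Multigraph (Fin n) → Prop) (k : ℕ) :
    Monotone (limsupTime F P k) := fun _ _ h =>
  limsup_le_limsup (Eventually.of_forall fun n =>
    ENNReal.div_le_div_right (ENat.toENNReal_mono (optTime_mono (P n) k h)) _)

/-- The limit in the definition of `threshold` exists. -/
theorem tendsto_limsupTime (F : Filter ℕ+) (P : ∀ n : ℕ+, Multigraph (Fin n) → Prop) (k : ℕ) :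
    Tendsto (limsupTime F P k) (𝓝[<] (1 : ℝ)) (𝓝 (threshold F P k)) :=
  tendsto_nhds_limUnder ⟨_, (limsupTime_mono F P k).tendsto_nhdsLT 1⟩

/-- The perfect-matching threshold `τ_PM(k)`. As a graph on an odd number of vertices has no
perfect matching, `n` tends to infinity through the even integers. -/
def pmThreshold (k : ℕ) : ℝ≥0∞ :=
  threshold (atTop ⊓ 𝓟 {n : ℕ+ | Even (n : ℕ)}) (fun _ => HasPerfectMatching) k

end SemiRandom

end

/-! A perfect matching uses n/2 edges and each round adds one, which gives the lower bound. For the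
upper bound, the player first matches greedily. While more than εn vertices are unmatched, some
square is unmatched with probability at least 1 - (1 - ε)^k, so the phase costs about n/2 · (1 + δ)
rounds if (1 - (1 - ε)^k)(1 + δ) > 1. For ε = log k / k the failure term (1 - ε)^k is at most 1/k,
and δ of order √ε suffices.

The last u ≤ εn vertices are matched by augmenting paths of length three, and one square per round
is enough. A square on a matched vertex is joined to an unmatched one and makes its mate ready; a
later square on a ready vertex augments. If every unmatched vertex is the target of c ready
vertices, an augmentation takes about n/(cu) rounds and destroys at most 2c ready vertices. The
choice c = √(n/u) balances the two costs, and the sum over u is O(√(un)) = O(√ε n).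

Instead of random trajectories, the proof bounds `loss`, the value function of the game, by backward
recursion. A bound exp(θ · (potential - t)) survives one round as soon as the potential drifts down
fast enough (`loss_succ_le_of_hit`, `exp_drift`). The two phases are `loss_le_of_isReady` and
`loss_le_greedy`. -/

namespace SemiRandom

/-! ### The optimal failure probability -/

open Classical in
/-- The failure probability, under optimal play, of the attempt to have a perfect matching after
`t` more rounds, if the rounds played so far are `h`. -/
noncomputable def loss (k : ℕ) {V : Type} [Fintype V] : ℕ → History V → ℝ
  | 0, h => if HasPerfectMatching h.graph then 0 else 1
  | t + 1, h => (∑ sq : Fin k → V, ⨅ c : Fin k × V, loss k t ((sq c.1, c.2) :: h)) /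
      (Fintype.card (Fin k → V) : ℝ)

variable {k : ℕ} {V : Type} [Fintype V]

theorem loss_nonneg (t : ℕ) (h : History V) : 0 ≤ loss k t h := by
  induction t generalizing h with
  | zero => rw [loss]; split_ifs <;> simp
  | succ t ih =>
    rw [loss]
    exact div_nonneg (Finset.sum_nonneg fun _ _ => Real.iInf_nonneg fun _ => ih _)
      (Nat.cast_nonneg _)

theorem tsum_bind_mul {α β : Type*} (p : PMF α) (f : α → PMF β) (g : β → ℝ≥0∞) :
    ∑' b, (p.bind f) b * g b = ∑' a, p a * ∑' b, f a b * g b := by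
  simp_rw [PMF.bind_apply, ← ENNReal.tsum_mul_right, ← ENNReal.tsum_mul_left]
  rw [ENNReal.tsum_comm]
  simp_rw [mul_assoc]

theorem tsum_pure_mul {α : Type*} (a : α) (g : α → ℝ≥0∞) :
    ∑' b, (PMF.pure a) b * g b = g a := by
  classical
  rw [tsum_eq_single a]
  · simp
  · intro b hb
    simp [hb]

variable [Nonempty V]

theorem length_of_mem_support (S : Strategy k V)
    (t : ℕ) : ∀ h ∈ (historyLaw S t).support, h.length = t := by
  induction t with
  | zero => intro h hh; simpa [historyLaw] using hh
  | succ t ih =>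
    intro h hh
    simp only [historyLaw, PMF.mem_support_bind_iff, PMF.mem_support_map_iff] at hh
    obtain ⟨h', hh', sq, -, c, -, rfl⟩ := hh
    simp [ih h' hh']

/-- Some strategy attains the optimal failure probability. -/
theorem exists_strategy [NeZero k] (T : ℕ) : ∃ S : Strategy k V,
    1 ≤ (graphLaw S T).toOuterMeasure {G | HasPerfectMatching G} +
      ENNReal.ofReal (loss k T ([] : History V)) := by
  classical
  have hch : ∀ (h : History V) (sq : Fin k → V), ∃ c : Fin k × V,
      loss k (T - (h.length + 1)) ((sq c.1, c.2) :: h) =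
        ⨅ c : Fin k × V, loss k (T - (h.length + 1)) ((sq c.1, c.2) :: h) := fun h sq =>
    exists_eq_ciInf_of_finite
  choose f hf using hch
  let S : Strategy k V := fun h sq => PMF.pure (f h sq)
  -- Under the strategy that minimizes at every step, the expected optimal loss over the remaining
  -- rounds is constant in time. The strategy reads the number of remaining rounds from the length
  -- of the history.
  have key : ∀ t ≤ T, ∑' h, historyLaw S t h * ENNReal.ofReal (loss k (T - t) h) =
      ENNReal.ofReal (loss k T ([] : History V)) := by
    intro t
    induction t with
    | zero => intro _; simp [historyLaw]
    | succ t ih =>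
      intro ht
      rw [← ih (by omega), historyLaw, tsum_bind_mul]
      refine tsum_congr fun h => ?_
      by_cases hh : historyLaw S t h = 0
      · simp [hh]
      congr 1
      have hl : h.length = t := length_of_mem_support S t h ((PMF.mem_support_iff _ _).2 hh)
      have e : T - t = (T - (t + 1)) + 1 := by omega
      rw [tsum_bind_mul, e, loss, Finset.sum_div, ENNReal.ofReal_sum_of_nonneg, tsum_fintype]
      · refine Finset.sum_congr rfl fun sq _ => ?_
        simp only [S, PMF.pure_map, tsum_pure_mul]
        have := hf h sq
        rw [hl] at this
        rw [this, PMF.uniformOfFintype_apply, div_eq_inv_mul, ENNReal.ofReal_mul (by positivity),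
          ENNReal.ofReal_inv_of_pos (by exact_mod_cast Fintype.card_pos), ENNReal.ofReal_natCast]
      · intro sq _
        exact div_nonneg (Real.iInf_nonneg fun _ => loss_nonneg _ _) (Nat.cast_nonneg _)
  refine ⟨S, ?_⟩
  have h1 := key T le_rfl
  rw [← h1, graphLaw, PMF.toOuterMeasure_map_apply, PMF.toOuterMeasure_apply, ← ENNReal.tsum_add,
    ← (historyLaw S T).tsum_coe]
  refine ENNReal.tsum_le_tsum fun h => ?_
  by_cases hp : HasPerfectMatching h.graph
  · simp [Set.indicator, hp]
  · simp [Set.indicator, hp, loss]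

theorem optTime_le [NeZero k] {q : ℝ} (hq : 0 ≤ q) {T : ℕ}
    (h : loss k T ([] : History V) ≤ 1 - q) :
    optTime (V := V) HasPerfectMatching q k ≤ T := by
  obtain ⟨S, hS⟩ := exists_strategy (k := k) (V := V) T
  refine (iInf_le _ S).trans (iInf₂_le T ?_)
  have h2 : ENNReal.ofReal q + ENNReal.ofReal (loss k T ([] : History V)) ≤ 1 := by
    rw [← ENNReal.ofReal_add hq (loss_nonneg _ _), ← ENNReal.ofReal_one]
    exact ENNReal.ofReal_le_ofReal (by linarith)
  exact (ENNReal.add_le_add_iff_right ENNReal.ofReal_ne_top).1 (h2.trans hS)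

theorem loss_succ_le_sum [NeZero k] (t : ℕ) (h : History V) (g : (Fin k → V) → ℝ)
    (hg : ∀ sq, ∃ c : Fin k × V, loss k t ((sq c.1, c.2) :: h) ≤ g sq) :
    loss k (t + 1) h ≤ (∑ sq, g sq) / (Fintype.card (Fin k → V) : ℝ) := by
  rw [loss]
  gcongr with sq
  obtain ⟨c, hc⟩ := hg sq
  exact (ciInf_le (Set.finite_range _).bddBelow c).trans hc

/-- If hitting the target set `B` improves the bound `b` for the failure probability to `a`, then
one round with `k` squares gains accordingly. -/
theorem loss_succ_le_of_hit [NeZero k] {t : ℕ} {h : History V} {a b f : ℝ} (B : Finset V)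
    (hab : a ≤ b) (hit : ∀ u ∈ B, ∃ v, loss k t ((u, v) :: h) ≤ a)
    (miss : ∀ u, ∃ v, loss k t ((u, v) :: h) ≤ b)
    (hf : (1 - (B.card : ℝ) / Fintype.card V) ^ k ≤ f) :
    loss k (t + 1) h ≤ (1 - f) * a + f * b := by
  classical
  -- The tuples all of whose squares miss `B`.
  let Z : Finset (Fin k → V) := Fintype.piFinset fun _ => Bᶜ
  have hZ : (Z.card : ℝ) = (1 - (B.card : ℝ) / Fintype.card V) ^ k *
      (Fintype.card (Fin k → V) : ℝ) := by
    have hV : (Fintype.card V : ℝ) ≠ 0 := by exact_mod_cast Fintype.card_ne_zero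
    simp only [Z, Fintype.card_piFinset, Finset.prod_const, Finset.card_univ, Fintype.card_fin,
      Fintype.card_fun, Nat.cast_pow]
    rw [← mul_pow, Finset.card_compl, Nat.cast_sub (Finset.card_le_univ _)]
    congr 1
    field_simp
  have hN : (0 : ℝ) < (Fintype.card (Fin k → V) : ℝ) := by exact_mod_cast Fintype.card_pos
  have h1 := loss_succ_le_sum (k := k) t h (fun sq => if sq ∈ Z then b else a) (by
    intro sq
    by_cases hs : sq ∈ Z
    · obtain ⟨v, hv⟩ := miss (sq 0)
      exact ⟨(0, v), by simpa [hs] using hv⟩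
    · obtain ⟨i, hi⟩ : ∃ i, sq i ∈ B := by simpa [Z] using hs
      obtain ⟨v, hv⟩ := hit _ hi
      exact ⟨(i, v), by simpa [hs] using hv⟩)
  refine h1.trans ?_
  have h2 : (∑ sq : Fin k → V, if sq ∈ Z then b else a) =
      (Fintype.card (Fin k → V) : ℝ) * a + Z.card * (b - a) := by
    have : ∀ sq : Fin k → V, (if sq ∈ Z then b else a) = a + if sq ∈ Z then (b - a) else 0 := by
      intro sq; split_ifs <;> ring
    simp_rw [this, Finset.sum_add_distrib]
    simp [mul_sub]
  rw [h2, hZ, div_le_iff₀ hN]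
  nlinarith [mul_nonneg (mul_nonneg (sub_nonneg.2 hf) (sub_nonneg.2 hab)) hN.le]

theorem loss_le_one [NeZero k] (t : ℕ) (h : History V) : loss k t h ≤ 1 := by
  induction t generalizing h with
  | zero => rw [loss]; split_ifs <;> simp
  | succ t ih =>
    have := loss_succ_le_of_hit (k := k) (t := t) (h := h) (a := 1) (b := 1) (f := 1) ∅ le_rfl
      (by simp) (fun u => ⟨u, ih _⟩) (by simp)
    simpa using this

end SemiRandom

namespace SemiRandom

variable {k : ℕ} {V : Type} {h : History V} {m : V → V}

/-! ### Matchings as involutions -/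

theorem mem_graph_cons {e : Sym2 V} {u v : V} :
    e ∈ History.graph ((u, v) :: h) ↔ e = s(u, v) ∨ e ∈ h.graph := by
  simp [History.graph]

/-- The involution `m` is a matching in the graph of `h`; its fixed points are unmatched. -/
structure IsMatchingMap (h : History V) (m : V → V) : Prop where
  invol : ∀ v, m (m v) = v
  edge : ∀ v, m v ≠ v → s(v, m v) ∈ h.graph

theorem IsMatchingMap.cons (hm : IsMatchingMap h m) (e : V × V) : IsMatchingMap (e :: h) m :=
  ⟨hm.invol, fun v hv => mem_graph_cons.2 (Or.inr (hm.edge v hv))⟩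

theorem isMatchingMap_id : IsMatchingMap h (fun v => v) := ⟨fun _ => rfl, fun _ h => absurd rfl h⟩

theorem IsMatchingMap.hasPerfectMatching (hm : IsMatchingMap h m) (hu : ∀ v, m v ≠ v) :
    HasPerfectMatching h.graph := by
  refine ⟨{ verts := Set.univ, Adj := fun a b => m a = b, adj_sub := ?_, edge_vert := ?_,
            symm := ?_ }, ?_, ?_⟩
  · rintro a b rfl
    exact ⟨hm.edge a (hu a), (hu a).symm⟩
  · intros; trivial
  · refine ⟨?_⟩
    rintro a b rfl
    exact hm.invol a
  · intro v _
    exact ⟨m v, rfl, fun w hw => Eq.symm hw⟩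
  · intro v; trivial

/-! ### Ready vertices -/

/-- `R` is a set of ready vertices with targets `x`: a matched vertex `b` is ready if its mate is
joined to the unmatched vertex `x b`, so that one edge from `b` to another unmatched vertex
completes an augmenting path. -/
structure IsReady (h : History V) (m : V → V) (R : Finset V) (x : V → V) : Prop where
  matched : ∀ b ∈ R, m b ≠ b
  disj : ∀ b ∈ R, m b ∉ R
  target : ∀ b ∈ R, m (x b) = x b
  edge : ∀ b ∈ R, s(m b, x b) ∈ h.graph

theorem IsReady.cons {R : Finset V} {x : V → V} (hR : IsReady h m R x) (e : V × V) : IsReady (e :: h) m R x :=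
  ⟨hR.matched, hR.disj, hR.target, fun b hb => mem_graph_cons.2 (Or.inr (hR.edge b hb))⟩

/-! ### Changing the matching -/

variable [DecidableEq V]

/-- The vertices that are not matched by `m`. -/
def unmatched [Fintype V] (m : V → V) : Finset V := Finset.univ.filter fun v => m v = v

@[simp] theorem mem_unmatched [Fintype V] {v : V} : v ∈ unmatched m ↔ m v = v := by simp [unmatched]

/-- An involution moves points in pairs. Hence an unmatched vertex always has an unmatched partner.
-/
theorem IsMatchingMap.even_card [Fintype V] (hm : IsMatchingMap h m) (hV : Even (Fintype.card V)) :
    Even (unmatched m).card := by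
  have h1 := Equiv.Perm.card_fixedPoints_modEq (f := m) (p := 2) (n := 1)
    (by funext v; exact hm.invol v)
  have h2 : Fintype.card (Function.fixedPoints m) = (unmatched m).card := by
    rw [Fintype.card_subtype]; rfl
  rw [h2] at h1
  rw [Nat.even_iff] at hV ⊢
  rw [← hV]; exact h1.symm

theorem IsMatchingMap.loss_eq_zero [Fintype V] [Nonempty V] [NeZero k] (hm : IsMatchingMap h m)
    (hu : (unmatched m).card = 0) (t : ℕ) : loss k t h = 0 := by
  refine le_antisymm ?_ (loss_nonneg _ _)
  induction t generalizing h with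
  | zero =>
    have : HasPerfectMatching h.graph := hm.hasPerfectMatching fun v hv => by
      rw [Finset.card_eq_zero] at hu
      exact Finset.notMem_empty v (hu ▸ mem_unmatched.2 hv)
    simp [loss, this]
  | succ t ih =>
    simpa using loss_succ_le_of_hit (k := k) (t := t) (h := h) (a := 0) (b := 0) (f := 1) ∅ le_rfl
      (by simp) (fun u => ⟨u, ih (hm.cons _)⟩) (by simp)

/-- Match the two unmatched vertices `u` and `w`. -/
def matchPair (m : V → V) (u w : V) : V → V :=
  fun v => if v = u then w else if v = w then u else m v

theorem IsMatchingMap.matchPair (hm : IsMatchingMap h m) {u w : V} (hu : m u = u) (hw : m w = w) :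
    IsMatchingMap ((u, w) :: h) (matchPair m u w) := by
  have hi := hm.invol
  refine ⟨fun v => ?_, fun v hv => ?_⟩
  · unfold SemiRandom.matchPair
    grind
  · rw [mem_graph_cons]
    by_cases h1 : v = u
    · simp [SemiRandom.matchPair, h1]
    by_cases h2 : v = w
    · simp [SemiRandom.matchPair, h2]
    simp only [SemiRandom.matchPair, h1, h2, if_false] at hv ⊢
    exact Or.inr (hm.edge v hv)

theorem card_unmatched_matchPair [Fintype V] {u w : V} (huw : u ≠ w) (hu : m u = u) (hw : m w = w) :
    (unmatched (matchPair m u w)).card + 2 = (unmatched m).card := by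
  have : unmatched m = insert u (insert w (unmatched (matchPair m u w))) := by
    ext v
    simp only [Finset.mem_insert, mem_unmatched, matchPair]
    grind
  rw [this, Finset.card_insert_of_notMem, Finset.card_insert_of_notMem]
  · simp [matchPair]; grind
  · simp [matchPair]; grind

/-- Augment the matching along the path `x, m b, b, y`. -/
def augment (m : V → V) (b x y : V) : V → V :=
  fun v => if v = m b then x else if v = x then m b else if v = b then y
    else if v = y then b else m v

theorem IsMatchingMap.augment (hm : IsMatchingMap h m) {b x y : V} (hb : m b ≠ b) (hx : m x = x)
    (hy : m y = y) (hxy : x ≠ y) (he : s(m b, x) ∈ h.graph) :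
    IsMatchingMap ((b, y) :: h) (augment m b x y) := by
  have hi := hm.invol
  refine ⟨fun v => ?_, fun v hv => ?_⟩
  · have := hi b
    have := hi v
    unfold SemiRandom.augment
    grind
  · rw [mem_graph_cons]
    by_cases h1 : v = m b
    · simp [SemiRandom.augment, h1, he]
    by_cases h2 : v = x
    · right
      subst h2
      simpa [SemiRandom.augment, h1, Sym2.eq_swap] using he
    by_cases h3 : v = b
    · left
      subst h3
      simp [SemiRandom.augment, hb.symm, h2]
    by_cases h4 : v = y
    · left
      subst h4
      simp [SemiRandom.augment, h1, h2, h3, Sym2.eq_swap]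
    simp only [SemiRandom.augment, h1, h2, h3, h4, if_false] at hv ⊢
    exact Or.inr (hm.edge v hv)

theorem card_unmatched_augment [Fintype V] (hm : IsMatchingMap h m) {b x y : V} (hb : m b ≠ b) (hx : m x = x)
    (hy : m y = y) (hxy : x ≠ y) :
    (unmatched (augment m b x y)).card + 2 = (unmatched m).card := by
  have hib := hm.invol b
  have : unmatched m = insert x (insert y (unmatched (augment m b x y))) := by
    ext v
    simp only [Finset.mem_insert, mem_unmatched, augment]
    grind
  rw [this, Finset.card_insert_of_notMem, Finset.card_insert_of_notMem]
  · simp [augment]; grind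
  · simp [augment]; grind

/-- The number of ready vertices with target `z`. -/
def load (R : Finset V) (x : V → V) (z : V) : ℕ := (R.filter fun b => x b = z).card

variable {R : Finset V} {x : V → V}

theorem IsReady.card_eq [Fintype V] (hR : IsReady h m R x) : R.card = ∑ z ∈ unmatched m, load R x z :=
  Finset.card_eq_sum_card_fiberwise fun b hb => mem_unmatched.2 (hR.target b hb)

/-- A hit of the vertex `a` makes its mate ready. -/
theorem IsReady.insert (hm : IsMatchingMap h m) (hR : IsReady h m R x) {a z : V} (ha : m a ≠ a)
    (haR : a ∉ R) (hmR : m a ∉ R) (hz : m z = z) :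
    IsReady ((a, z) :: h) m (insert (m a) R) (Function.update x (m a) z) := by
  have hi := hm.invol a
  have hne : ∀ b ∈ R, b ≠ m a := fun b hb e => hmR (e ▸ hb)
  refine ⟨?_, ?_, ?_, ?_⟩ <;> intro b hb <;> rcases Finset.mem_insert.1 hb with rfl | hb
  · rw [hi]; exact ha.symm
  · exact hR.matched b hb
  · rw [hi]; simp [haR, ha.symm]
  · have h1 := hm.invol b
    have h2 := hR.disj b hb
    simp only [Finset.mem_insert, not_or]
    exact ⟨fun e => haR (by rw [e, hi] at h1; exact h1 ▸ hb), h2⟩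
  · simpa using hz
  · simpa [Function.update_of_ne (hne b hb)] using hR.target b hb
  · simp [mem_graph_cons, hi]
  · rw [mem_graph_cons, Function.update_of_ne (hne b hb)]
    exact Or.inr (hR.edge b hb)

theorem load_insert {b z : V} (hb : b ∉ R) (w : V) :
    load (insert b R) (Function.update x b z) w = load R x w + if w = z then 1 else 0 := by
  have h1 : R.filter (fun v => Function.update x b z v = w) = R.filter (fun v => x v = w) := by
    refine Finset.filter_congr fun v hv => ?_
    rw [Function.update_of_ne (fun e : v = b => hb (e ▸ hv))]
  unfold load
  rw [Finset.filter_insert, Function.update_self, h1]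
  by_cases hw : w = z
  · rw [if_pos hw.symm, if_pos hw, Finset.card_insert_of_notMem (by simp [hb])]
  · rw [if_neg (Ne.symm hw), if_neg hw, add_zero]

/-- Only ready vertices aimed at the two newly matched endpoints are lost, among them `b` itself.
The others lie on other matching edges, by `disj`, so their mates do not change. -/
theorem IsReady.augment (hm : IsMatchingMap h m) (hR : IsReady h m R x) {b y : V} (hb : b ∈ R)
    (hy : m y = y) (e : V × V) :
    IsReady (e :: h) (augment m b (x b) y)
      (R.filter fun v => x v ≠ x b ∧ x v ≠ y) x := by
  have key : ∀ v ∈ R.filter (fun v => x v ≠ x b ∧ x v ≠ y),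
      SemiRandom.augment m b (x b) y v = m v := by
    intro v hv
    obtain ⟨hv, h1, h2⟩ := by simpa using hv
    have := hR.matched v hv
    have := hR.disj b hb
    have := hR.target b hb
    unfold SemiRandom.augment
    grind
  have hmb := hR.matched b hb
  have hib := hm.invol b
  refine ⟨?_, ?_, ?_, ?_⟩ <;> intro v hv <;> have hk := key v hv <;>
    obtain ⟨hv, h1, h2⟩ := by simpa using hv
  · rw [hk]; exact hR.matched v hv
  · rw [hk]; simp [hR.disj v hv]
  · have := hR.target v hv
    unfold SemiRandom.augment
    grind
  · rw [hk, show e = (e.1, e.2) from rfl, mem_graph_cons]; exact Or.inr (hR.edge v hv)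

theorem card_le_filter_add_load (y z : V) :
    R.card ≤ (R.filter fun v => x v ≠ z ∧ x v ≠ y).card + load R x z + load R x y := by
  have : R ⊆ (R.filter fun v => x v ≠ z ∧ x v ≠ y) ∪ (R.filter fun v => x v = z) ∪
      (R.filter fun v => x v = y) := by
    intro v hv
    simp only [Finset.mem_union, Finset.mem_filter]
    tauto
  exact (Finset.card_le_card this).trans ((Finset.card_union_le _ _).trans
    (Nat.add_le_add_right (Finset.card_union_le _ _) _))

theorem load_mono {R' : Finset V} (hR : R' ⊆ R) (z : V) : load R' x z ≤ load R x z :=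
  Finset.card_le_card (Finset.filter_subset_filter _ hR)

end SemiRandom

namespace SemiRandom

/-! ### Capacities -/

/-- The number of ready vertices that may have the same target when `u` of `n` vertices are
unmatched. -/
noncomputable def cap (n u : ℕ) : ℕ := ⌈√((n : ℝ) / u)⌉₊

/-- The potential `∑_{j ≤ u} cap n j`. -/
noncomputable def capSum (n u : ℕ) : ℕ := ∑ j ∈ Finset.range u, cap n (j + 1)

theorem cap_anti {n u v : ℕ} (hu : 1 ≤ u) (huv : u ≤ v) : cap n v ≤ cap n u := by
  have : (1 : ℝ) ≤ u := by exact_mod_cast hu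
  unfold cap
  gcongr

theorem sqrt_le_cap (n u : ℕ) : √((n : ℝ) / u) ≤ cap n u := Nat.le_ceil _

theorem cap_le {n u : ℕ} (hu : 1 ≤ u) (hun : u ≤ n) : (cap n u : ℝ) ≤ 2 * √((n : ℝ) / u) := by
  have h0 : (1 : ℝ) ≤ u := by exact_mod_cast hu
  have h1 : (1 : ℝ) ≤ √((n : ℝ) / u) := by
    rw [Real.one_le_sqrt, le_div_iff₀ (by linarith), one_mul]
    exact_mod_cast hun
  have := (Nat.ceil_lt_add_one (Real.sqrt_nonneg ((n : ℝ) / u))).le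
  unfold cap
  linarith

theorem cap_mul_le {n u : ℕ} (hu : 1 ≤ u) (hun : u ≤ n) :
    (cap n u : ℝ) * u ≤ 2 * √((n : ℝ) * u) := by
  have h0 : (1 : ℝ) ≤ u := by exact_mod_cast hu
  have h2 : √((n : ℝ) / u) * u = √((n : ℝ) * u) := by
    rw [← Real.sqrt_sq (by linarith : (0 : ℝ) ≤ u), ← Real.sqrt_mul (by positivity),
      Real.sqrt_sq (by linarith)]
    congr 1
    field_simp
  rw [← h2]
  nlinarith [cap_le hu hun]

theorem cap_mul_le_capSum (n u : ℕ) : cap n u * u ≤ capSum n u := by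
  have := Finset.card_nsmul_le_sum (Finset.range u) (fun j => cap n (j + 1)) (cap n u)
    (fun j hj => cap_anti (by omega) (by have := Finset.mem_range.1 hj; omega))
  simpa [capSum, mul_comm] using this

/-- An augmentation lowers the number of unmatched vertices by two; this is the resulting drop of
the potential. -/
theorem capSum_add_two_le (n u : ℕ) : capSum n u + 2 * cap n (u + 2) ≤ capSum n (u + 2) := by
  have : cap n (u + 2) ≤ cap n (u + 1) := cap_anti (by omega) (by omega)
  have e : capSum n (u + 2) = capSum n u + cap n (u + 1) + cap n (u + 2) := by
    simp [capSum, Finset.sum_range_succ]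
  omega

theorem capSum_le_aux (n u : ℕ) : (capSum n u : ℝ) ≤ 2 * √((n : ℝ) * u) + u := by
  induction u with
  | zero => simp [capSum]
  | succ u ih =>
    have h1 := (Nat.ceil_lt_add_one (Real.sqrt_nonneg ((n : ℝ) / (u + 1 : ℕ)))).le
    have h2 : capSum n (u + 1) = capSum n u + cap n (u + 1) := by
      simp [capSum, Finset.sum_range_succ]
    -- Telescoping form of ∑ 1/√j ≤ 2√u.
    have h3 : √((n : ℝ) / (u + 1 : ℕ)) ≤ 2 * √((n : ℝ) * (u + 1 : ℕ)) - 2 * √((n : ℝ) * u) := by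
      have hs : (0 : ℝ) < √((u : ℝ) + 1) := by positivity
      have ha := Real.sq_sqrt (by positivity : (0 : ℝ) ≤ (u : ℝ) + 1)
      have hb := Real.sq_sqrt (by positivity : (0 : ℝ) ≤ (u : ℝ))
      rw [Real.sqrt_div (by positivity), Real.sqrt_mul (by positivity),
        Real.sqrt_mul (by positivity)]
      push_cast
      rw [div_le_iff₀ hs]
      have hc : √(n : ℝ) * (√((u : ℝ) + 1) ^ 2 - √(u : ℝ) ^ 2) = √(n : ℝ) := by
        rw [ha, hb]; ring
      nlinarith [mul_nonneg (Real.sqrt_nonneg (n : ℝ)) (sq_nonneg (√((u : ℝ) + 1) - √(u : ℝ)))]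
    rw [h2]
    push_cast at h1 h3 ⊢
    unfold cap
    push_cast
    linarith

theorem capSum_le {n u : ℕ} (hun : u ≤ n) : (capSum n u : ℝ) ≤ 3 * √((n : ℝ) * u) := by
  have h1 := capSum_le_aux n u
  have h2 : (u : ℝ) ≤ √((n : ℝ) * u) := by
    apply Real.le_sqrt_of_sq_le
    have : (u : ℝ) ≤ n := by exact_mod_cast hun
    nlinarith [(Nat.cast_nonneg u : (0 : ℝ) ≤ u)]
  linarith

/-- The potential `Y` falls by `d` on a hit and stays on a miss. Since exp(-a) ≤ 1 - a + a² for 0 ≤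
a ≤ 1, a drift of at least 1 after the second-order correction `1 - θ * d` pays for one round. -/
theorem exp_drift {θ f d Y : ℝ} (hθ : 0 ≤ θ) (hd : 0 ≤ d) (hd1 : θ * d ≤ 1) (hf : f ≤ 1)
    (h : 1 ≤ (1 - f) * (d * (1 - θ * d))) :
    (1 - f) * Real.exp (θ * (Y - d)) + f * Real.exp (θ * Y) ≤ Real.exp (θ * (Y - 1)) := by
  have ha : 0 ≤ θ * d := mul_nonneg hθ hd
  have h1 : Real.exp (-(θ * d)) ≤ 1 - θ * d + (θ * d) ^ 2 := by
    have := (abs_le.1 (Real.abs_exp_sub_one_sub_id_le (x := -(θ * d))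
      (by rw [abs_neg, abs_of_nonneg ha]; exact hd1))).2
    nlinarith
  have h2 : 1 - θ ≤ Real.exp (-θ) := Real.one_sub_le_exp_neg θ
  have h3 : (1 - f) * Real.exp (-(θ * d)) + f ≤ Real.exp (-θ) := by
    have := mul_le_mul_of_nonneg_left h1 (sub_nonneg.2 hf)
    have := mul_le_mul_of_nonneg_left h hθ
    nlinarith
  have e1 : θ * (Y - d) = θ * Y + -(θ * d) := by ring
  have e2 : θ * (Y - 1) = θ * Y + -θ := by ring
  rw [e1, e2, Real.exp_add, Real.exp_add]
  have := mul_le_mul_of_nonneg_left h3 (Real.exp_pos (θ * Y)).le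
  linarith

/-! ### Completing an almost perfect matching -/

variable {k : ℕ} {V : Type} [Fintype V]

/-- The rate in the exponential bounds for the failure probability. -/
noncomputable def rate (V : Type) [Fintype V] : ℝ := 1 / (8 * √(Fintype.card V : ℝ))

theorem rate_pos [Nonempty V] : 0 < rate V := by
  have : (0 : ℝ) < Fintype.card V := by exact_mod_cast Fintype.card_pos
  unfold rate
  positivity

variable [DecidableEq V]

/-- Hitting a ready vertex completes an augmenting path. -/
theorem exists_of_hit_ready (hV : Even (Fintype.card V)) {h : History V} {m x : V → V}
    {R : Finset V} (hm : IsMatchingMap h m) (hR : IsReady h m R x)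
    (hl : ∀ z, load R x z ≤ cap (Fintype.card V) (unmatched m).card) {b : V} (hb : b ∈ R) :
    ∃ y, ∃ (m' : V → V) (R' : Finset V), IsMatchingMap ((b, y) :: h) m' ∧
      IsReady ((b, y) :: h) m' R' x ∧ (unmatched m').card + 2 = (unmatched m).card ∧
      (∀ z, load R' x z ≤ cap (Fintype.card V) (unmatched m).card) ∧
      R.card ≤ R'.card + 2 * cap (Fintype.card V) (unmatched m).card := by
  have hx := hR.target b hb
  have hxm := mem_unmatched.2 hx
  have h1 : 1 < (unmatched m).card := by
    have := Finset.card_pos.2 ⟨_, hxm⟩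
    obtain ⟨r, hr⟩ := hm.even_card hV
    omega
  obtain ⟨y, hy, hyx⟩ := Finset.exists_mem_ne h1 (x b)
  have hy' := mem_unmatched.1 hy
  refine ⟨y, augment m b (x b) y, _, hm.augment (hR.matched b hb) hx hy' hyx.symm (hR.edge b hb),
    hR.augment hm hb hy' _, card_unmatched_augment hm (hR.matched b hb) hx hy' hyx.symm,
    fun z => (load_mono (Finset.filter_subset _ _) z).trans (hl z), ?_⟩
  have := card_le_filter_add_load (R := R) (x := x) y (x b)
  have := hl y
  have := hl (x b)
  omega

/-- A vertex is not fresh only if it is unmatched, ready, or the mate of a ready vertex. -/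
theorem card_fresh {m : V → V} (hi : ∀ v, m (m v) = v) (R : Finset V) :
    Fintype.card V ≤ (Finset.univ.filter fun a => m a ≠ a ∧ a ∉ R ∧ m a ∉ R).card +
      (unmatched m).card + 2 * R.card := by
  have h1 : (Finset.univ : Finset V) ⊆
      (Finset.univ.filter fun a => m a ≠ a ∧ a ∉ R ∧ m a ∉ R) ∪ unmatched m ∪ R ∪ R.image m := by
    intro v _
    by_cases hv : m v ∈ R
    · have : v ∈ R.image m := Finset.mem_image.2 ⟨_, hv, hi v⟩
      simp [this]
    · simp only [Finset.mem_union, Finset.mem_filter, Finset.mem_univ, true_and, mem_unmatched]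
      tauto
  have h2 := Finset.card_le_card h1
  have h3 := Finset.card_union_le ((Finset.univ.filter fun a => m a ≠ a ∧ a ∉ R ∧ m a ∉ R) ∪
    unmatched m ∪ R) (R.image m)
  have h4 := Finset.card_union_le ((Finset.univ.filter fun a => m a ≠ a ∧ a ∉ R ∧ m a ∉ R) ∪
    unmatched m) R
  have h5 := Finset.card_union_le (Finset.univ.filter fun a => m a ≠ a ∧ a ∉ R ∧ m a ∉ R)
    (unmatched m)
  have h6 := Finset.card_image_le (s := R) (f := m)
  rw [Finset.card_univ] at h2
  omega

/-- Discards all but one of the `k` squares. -/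
theorem pow_le_of_le_one_sub [NeZero k] {p f : ℝ} (hp : p ≤ 1) (hp0 : 0 ≤ p) (hf : 1 - f ≤ p) :
    (1 - p) ^ k ≤ f := by
  have := pow_le_of_le_one (sub_nonneg.2 hp) (by linarith : 1 - p ≤ 1) (NeZero.ne k)
  linarith

variable [Nonempty V] [NeZero k]

/-- Potential argument. A new ready vertex gains 4. An augmentation gains at least 10c from `capSum`
and loses at most 8c with the destroyed ready vertices, where c is the capacity; the net gain is 2c.
The weights 5 and 4 also keep the potential nonnegative, as |R| ≤ `capSum`. -/
theorem loss_le_of_isReady (hV : Even (Fintype.card V)) (t : ℕ) (h : History V) (m x : V → V)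
    (R : Finset V) (hm : IsMatchingMap h m) (hR : IsReady h m R x)
    (hu : 100 * (unmatched m).card ≤ Fintype.card V)
    (hl : 0 < (unmatched m).card → ∀ z, load R x z ≤ cap (Fintype.card V) (unmatched m).card) :
    loss k t h ≤ Real.exp (rate V *
      (5 * capSum (Fintype.card V) (unmatched m).card - 4 * R.card - t)) := by
  induction t generalizing h m x R with
  | zero =>
    rcases Nat.eq_zero_or_pos (unmatched m).card with h0 | h0
    · rw [hm.loss_eq_zero h0]; positivity
    refine (loss_le_one _ _).trans (Real.one_le_exp (mul_nonneg rate_pos.le ?_))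
    have h1 : R.card ≤ capSum (Fintype.card V) (unmatched m).card := by
      refine le_trans ?_ (cap_mul_le_capSum _ _)
      rw [hR.card_eq, mul_comm]
      exact Finset.sum_le_card_nsmul _ _ _ fun z _ => hl h0 z
    have h2 : (R.card : ℝ) ≤ capSum (Fintype.card V) (unmatched m).card := by exact_mod_cast h1
    have : (0 : ℝ) ≤ R.card := Nat.cast_nonneg _
    push_cast
    linarith
  | succ t ih =>
    rcases Nat.eq_zero_or_pos (unmatched m).card with h0 | h0
    · rw [hm.loss_eq_zero h0]; positivity
    have hl' := hl h0
    set n := Fintype.card V with hn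
    set u := (unmatched m).card with hu'
    have hun : u ≤ n := by omega
    have hn0 : (0 : ℝ) < n := by exact_mod_cast (by omega : 0 < n)
    have hu0 : (1 : ℝ) ≤ u := by exact_mod_cast h0
    have hsn : 1 ≤ √(n : ℝ) := by
      rw [Real.one_le_sqrt]; exact_mod_cast (by omega : 1 ≤ n)
    have hRn : (R.card : ℝ) ≤ n := by exact_mod_cast Finset.card_le_univ R
    have hθ : rate V * (8 * √(n : ℝ)) = 1 := by
      unfold rate
      rw [← hn]
      field_simp
    have hθ0 := rate_pos (V := V)
    set θ := rate V
    set Y : ℝ := 5 * capSum n u - 4 * R.card - t with hY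
    have eY : (5 * capSum n u - 4 * R.card - (t + 1 : ℕ) : ℝ) = Y - 1 := by
      rw [hY]; push_cast; ring
    rw [eY]
    have miss : ∀ w v, loss k t ((w, v) :: h) ≤ Real.exp (θ * Y) := fun w v =>
      ih _ m x R (hm.cons _) (hR.cons _) hu hl
    -- If some target has room, more ready vertices are collected; otherwise the player waits for a
    -- ready square.
    by_cases hfull : ∃ z, m z = z ∧ load R x z < cap n u
    · obtain ⟨z, hz, hzl⟩ := hfull
      refine (loss_succ_le_of_hit (Finset.univ.filter fun a => m a ≠ a ∧ a ∉ R ∧ m a ∉ R)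
        (a := Real.exp (θ * (Y - 4))) (b := Real.exp (θ * Y)) (f := 1 / 2) ?_ ?_
        (fun w => ⟨w, miss w w⟩) ?_).trans (exp_drift hθ0.le (by norm_num) ?_ (by norm_num) ?_)
      · gcongr; linarith
      · intro a ha
        obtain ⟨ha, haR, hmR⟩ := by simpa using ha
        refine ⟨z, ?_⟩
        have := ih ((a, z) :: h) m _ _ (hm.cons _) (hR.insert hm ha haR hmR hz) hu (by
          intro _ w
          rw [load_insert hmR]
          split_ifs with hw
          · rw [hw]; exact hzl
          · exact hl' w)
        refine this.trans_eq ?_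
        rw [Finset.card_insert_of_notMem hmR, hY]
        push_cast
        congr 2
        ring
      -- As u ≤ n/100, |R| ≤ 2√(nu) ≤ n/5, so at least half of all vertices are fresh.
      · have hc := card_fresh hm.invol R
        rw [← hn, ← hu'] at hc
        have hRc : (R.card : ℝ) ≤ 2 * √((n : ℝ) * u) := by
          have : R.card ≤ cap n u * u := by
            rw [hR.card_eq, mul_comm]
            exact Finset.sum_le_card_nsmul _ _ _ fun z _ => hl' z
          exact le_trans (by exact_mod_cast this) (cap_mul_le h0 hun)
        have hu1 : 100 * (u : ℝ) ≤ n := by exact_mod_cast hu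
        have hs : √((n : ℝ) * u) ≤ n / 10 := by
          rw [Real.sqrt_le_left (by positivity)]
          nlinarith
        have hc' : (n : ℝ) ≤ (Finset.univ.filter fun a => m a ≠ a ∧ a ∉ R ∧ m a ∉ R).card + u +
          2 * R.card := by exact_mod_cast hc
        refine pow_le_of_le_one_sub ?_ (by positivity) ?_
        · rw [div_le_one hn0]; exact_mod_cast Finset.card_le_univ _
        · rw [le_div_iff₀ hn0]; linarith
      · nlinarith
      · nlinarith
    · push Not at hfull
      have hRu : (cap n u : ℝ) * u ≤ R.card := by
        have : u * cap n u ≤ R.card := by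
          rw [hR.card_eq]
          exact Finset.card_nsmul_le_sum _ _ _ fun z hz => hfull z (mem_unmatched.1 hz)
        rw [mul_comm]
        exact_mod_cast this
      have hc1 := cap_le h0 hun
      have hc2 := sqrt_le_cap n u
      have hsq : √((n : ℝ) / u) ≤ √(n : ℝ) :=
        Real.sqrt_le_sqrt (div_le_self hn0.le hu0)
      -- The rate is chosen for this: the largest gain 2c is at most 4√n, so the second-order
      -- correction costs at most a factor 1/2.
      have hθc : θ * (2 * cap n u) ≤ 1 / 2 := by nlinarith
      refine (loss_succ_le_of_hit R (a := Real.exp (θ * (Y - 2 * cap n u)))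
        (b := Real.exp (θ * Y)) (f := 1 - R.card / n) ?_ ?_
        (fun w => ⟨w, miss w w⟩) ?_).trans (exp_drift hθ0.le (by positivity) (by linarith) ?_ ?_)
      · gcongr
        have : (0 : ℝ) ≤ cap n u := Nat.cast_nonneg _
        linarith
      · intro b hb
        obtain ⟨y, m', R', hm', hR', hu2, hl2, hc⟩ := exists_of_hit_ready hV hm hR hl' hb
        refine ⟨y, (ih _ m' x R' hm' hR' (by omega) ?_).trans ?_⟩
        -- Capacities grow as u decreases, except that `cap n 0 = 0` by division by zero; hence the
        -- guard in `hl`.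
        · intro h0' z
          exact (hl2 z).trans (cap_anti h0' (by omega))
        · have h3 := capSum_add_two_le n (unmatched m').card
          rw [hu2, ← hu'] at h3
          rw [← hn, ← hu'] at hc
          have h3' : (capSum n (unmatched m').card : ℝ) + 2 * cap n u ≤ capSum n u := by
            exact_mod_cast h3
          have hc' : (R.card : ℝ) ≤ R'.card + 2 * cap n u := by exact_mod_cast hc
          refine Real.exp_le_exp.2 (mul_le_mul_of_nonneg_left ?_ hθ0.le)
          rw [hY]
          linarith
      · refine pow_le_of_le_one_sub ?_ (by positivity) (by rw [← hn]; linarith)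
        rw [← hn, div_le_one hn0]; exact hRn
      · have : 0 ≤ (R.card : ℝ) / n := by positivity
        linarith
      · have h1 : (n : ℝ) / u ≤ cap n u ^ 2 := by
          rw [← Real.sq_sqrt (by positivity : 0 ≤ (n : ℝ) / u)]
          gcongr
        rw [div_le_iff₀ (by linarith)] at h1
        -- A ready vertex is hit with probability |R|/n ≥ cu/n ≥ 1/c.
        have h2 : 1 ≤ (R.card : ℝ) / n * cap n u := by
          rw [div_mul_eq_mul_div, le_div_iff₀ hn0]
          nlinarith [(Nat.cast_nonneg (cap n u) : (0 : ℝ) ≤ cap n u)]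
        have h4 : (R.card : ℝ) / n * cap n u * 1 ≤
            (R.card : ℝ) / n * cap n u * (2 * (1 - θ * (2 * cap n u))) := by
          gcongr
          linarith
        nlinarith

/-- An almost perfect matching is completed in `15 √(u n)` rounds. -/
theorem loss_le_of_isMatchingMap (hV : Even (Fintype.card V)) (t : ℕ) (h : History V) (m : V → V)
    (hm : IsMatchingMap h m) (hu : 100 * (unmatched m).card ≤ Fintype.card V) :
    loss k t h ≤ Real.exp (rate V *
      (15 * √((Fintype.card V : ℝ) * (unmatched m).card) - t)) := by
  have h1 := loss_le_of_isReady (k := k) hV t h m id ∅ hm ⟨by simp, by simp, by simp, by simp⟩ hu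
    (by simp [load])
  refine h1.trans (Real.exp_le_exp.2 (mul_le_mul_of_nonneg_left ?_ rate_pos.le))
  have := capSum_le (n := Fintype.card V) (u := (unmatched m).card) (Finset.card_le_univ _)
  rw [Finset.card_empty, Nat.cast_zero]
  linarith

end SemiRandom

namespace SemiRandom

/-! ### The greedy phase -/

section Greedy

variable {k : ℕ} {V : Type} [Fintype V] [Nonempty V] [DecidableEq V] [NeZero k]

/-- While more than `ε n` vertices are unmatched, an unmatched square is matched greedily. -/
theorem loss_le_greedy (hV : Even (Fintype.card V)) {ε δ : ℝ} (hε0 : 0 < ε) (hε : ε ≤ 1 / 100)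
    (hδ : 0 ≤ δ) (hrate : rate V * (1 + δ) ≤ 1)
    (hslack : 1 ≤ (1 - (1 - ε) ^ k) * ((1 + δ) * (1 - rate V * (1 + δ))))
    (t : ℕ) (h : History V) (m : V → V) (hm : IsMatchingMap h m) :
    loss k t h ≤ Real.exp (rate V * ((1 + δ) / 2 * (unmatched m).card +
      15 * (√ε * Fintype.card V) - t)) := by
  have hθ0 := rate_pos (V := V)
  have hn0 : (0 : ℝ) < Fintype.card V := by exact_mod_cast Fintype.card_pos
  induction t generalizing h m with
  | zero =>
    refine (loss_le_one _ _).trans (Real.one_le_exp (mul_nonneg hθ0.le ?_))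
    push_cast
    rw [sub_zero]
    positivity
  | succ t ih =>
    -- Below εn the completion bound takes over: 15√(un) ≤ 15√ε n.
    by_cases hu : ((unmatched m).card : ℝ) ≤ ε * Fintype.card V
    · refine (loss_le_of_isMatchingMap hV (t + 1) h m hm ?_).trans
        (Real.exp_le_exp.2 (mul_le_mul_of_nonneg_left ?_ hθ0.le))
      · have : 100 * ((unmatched m).card : ℝ) ≤ Fintype.card V := by nlinarith
        exact_mod_cast this
      · have h1 : √((Fintype.card V : ℝ) * (unmatched m).card) ≤ √ε * Fintype.card V := by
          rw [Real.sqrt_le_left (by positivity), mul_pow, Real.sq_sqrt hε0.le]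
          nlinarith
        have h2 : 0 ≤ (1 + δ) / 2 * ((unmatched m).card : ℝ) := by positivity
        linarith
    · push Not at hu
      set Y : ℝ := (1 + δ) / 2 * (unmatched m).card + 15 * (√ε * Fintype.card V) - t with hY
      have eY : (1 + δ) / 2 * (unmatched m).card + 15 * (√ε * Fintype.card V) - (t + 1 : ℕ) =
          Y - 1 := by rw [hY]; push_cast; ring
      rw [eY]
      refine (loss_succ_le_of_hit (unmatched m) (a := Real.exp (rate V * (Y - (1 + δ))))
        (b := Real.exp (rate V * Y)) (f := (1 - ε) ^ k) ?_ ?_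
        (fun w => ⟨w, ih _ m (hm.cons _)⟩) ?_).trans
        (exp_drift hθ0.le (by positivity) hrate (pow_le_one₀ (by linarith) (by linarith)) hslack)
      · gcongr; linarith
      · intro v hv
        have h1 : 1 < (unmatched m).card := by
          have := Finset.card_pos.2 ⟨_, hv⟩
          obtain ⟨r, hr⟩ := hm.even_card hV
          omega
        obtain ⟨w, hw, hwv⟩ := Finset.exists_mem_ne h1 v
        rw [mem_unmatched] at hv hw
        refine ⟨w, (ih _ _ (hm.matchPair hv hw)).trans_eq ?_⟩
        rw [hY, ← card_unmatched_matchPair hwv.symm hv hw]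
        push_cast
        congr 2
        ring
      · have h1 : ε ≤ ((unmatched m).card : ℝ) / Fintype.card V := by
          rw [le_div_iff₀ hn0]; exact hu.le
        have h2 : ((unmatched m).card : ℝ) / Fintype.card V ≤ 1 := by
          rw [div_le_one hn0]; exact_mod_cast Finset.card_le_univ _
        exact pow_le_pow_left₀ (by linarith) (by linarith) k

end Greedy

/-! ### The upper bound -/

/-- The two phases need (1 + δ)/2 · n + 15√ε n rounds. The sixteenth √ε n is a surplus that makes
the failure probability decay like exp(-√ε√n/8); the 1/8 in `ev3` absorbs the rounding of the number
of rounds. -/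
theorem pmThreshold_le {k : ℕ} [NeZero k] {ε δ : ℝ} (hε0 : 0 < ε) (hε : ε ≤ 1 / 100) (hδ : 0 ≤ δ)
    (hslack : 1 < (1 - (1 - ε) ^ k) * (1 + δ)) :
    pmThreshold k ≤ ENNReal.ofReal ((1 + δ) / 2 + 16 * √ε) := by
  refine le_of_tendsto (tendsto_limsupTime _ _ k) ?_
  filter_upwards [Ico_mem_nhdsLT (show (0 : ℝ) < 1 by norm_num)] with q ⟨hq0, hq1⟩
  have hsq : Tendsto (fun n : ℕ => √(n : ℝ)) atTop atTop :=
    Real.tendsto_sqrt_atTop.comp tendsto_natCast_atTop_atTop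
  have hr : Tendsto (fun n : ℕ => 1 / (8 * √(n : ℝ)) * (1 + δ)) atTop (𝓝 0) := by
    have : Tendsto (fun n : ℕ => (1 / (8 * √(n : ℝ)))) atTop (𝓝 0) :=
      tendsto_const_nhds.div_atTop (hsq.const_mul_atTop (by norm_num))
    simpa using this.mul_const (1 + δ)
  have ev1 : ∀ᶠ n : ℕ in atTop, 1 / (8 * √(n : ℝ)) * (1 + δ) ≤ 1 :=
    hr.eventually (ge_mem_nhds (by norm_num))
  have ev2 : ∀ᶠ n : ℕ in atTop,
      1 ≤ (1 - (1 - ε) ^ k) * ((1 + δ) * (1 - 1 / (8 * √(n : ℝ)) * (1 + δ))) := by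
    have : Tendsto (fun n : ℕ => (1 - (1 - ε) ^ k) *
        ((1 + δ) * (1 - 1 / (8 * √(n : ℝ)) * (1 + δ)))) atTop
        (𝓝 ((1 - (1 - ε) ^ k) * ((1 + δ) * (1 - 0)))) :=
      ((tendsto_const_nhds.sub hr).const_mul _).const_mul _
    exact this.eventually (le_mem_nhds (by rw [sub_zero, mul_one]; exact hslack))
  have ev3 : ∀ᶠ n : ℕ in atTop, Real.exp (1 / 8 - √ε / 8 * √(n : ℝ)) ≤ 1 - q := by
    have h1 : Tendsto (fun n : ℕ => √ε / 8 * √(n : ℝ)) atTop atTop :=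
      hsq.const_mul_atTop (by positivity)
    have h2 : Tendsto (fun n : ℕ => Real.exp (1 / 8 - √ε / 8 * √(n : ℝ))) atTop (𝓝 0) :=
      Real.tendsto_exp_atBot.comp
        (tendsto_atBot_add_const_left _ _ (tendsto_neg_atTop_atBot.comp h1))
    exact h2.eventually (ge_mem_nhds (by linarith))
  refine limsup_le_of_le (by isBoundedDefault) ?_
  rw [eventually_inf_principal]
  filter_upwards [tendsto_PNat_val_atTop_atTop.eventually ev1,
    tendsto_PNat_val_atTop_atTop.eventually ev2,
    tendsto_PNat_val_atTop_atTop.eventually ev3] with n h1 h2 h3 heven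
  have hcard : Fintype.card (Fin n) = (n : ℕ) := Fintype.card_fin _
  have hnR : (1 : ℝ) ≤ (n : ℕ) := by exact_mod_cast n.pos
  have hs1 : 1 ≤ √((n : ℕ) : ℝ) := Real.one_le_sqrt.2 hnR
  set K : ℝ := (1 + δ) / 2 + 16 * √ε with hK
  have hK0 : 0 ≤ K := by positivity
  have hopt : optTime (V := Fin n) HasPerfectMatching q k ≤ (⌊K * (n : ℕ)⌋₊ : ℕ) := by
    refine optTime_le hq0 (le_trans ?_ h3)
    have hrate : rate (Fin n) = 1 / (8 * √((n : ℕ) : ℝ)) := by rw [rate, hcard]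
    refine (loss_le_greedy (V := Fin n) (by rw [hcard]; exact heven) hε0 hε hδ
      (by rw [hrate]; exact h1) (by rw [hrate]; exact h2) _ [] _ isMatchingMap_id).trans (Real.exp_le_exp.2 ?_)
    have hun : ((unmatched fun v : Fin n => v).card : ℝ) = (n : ℕ) := by simp [unmatched]
    have hfl := (Nat.lt_floor_add_one (K * (n : ℕ))).le
    rw [hun, hcard, hrate, div_mul_eq_mul_div, one_mul, div_le_iff₀ (by positivity)]
    have hss := Real.mul_self_sqrt (by linarith : (0 : ℝ) ≤ (n : ℕ))
    have e : (1 / 8 - √ε / 8 * √((n : ℕ) : ℝ)) * (8 * √((n : ℕ) : ℝ)) =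
        √((n : ℕ) : ℝ) - √ε * (n : ℕ) := by
      linear_combination (-√ε) * hss
    rw [e]
    rw [hK] at hfl
    linarith
  rw [ENNReal.div_le_iff (by simp) (by simp)]
  calc ((optTime (V := Fin n) HasPerfectMatching q k : ℕ∞) : ℝ≥0∞)
      ≤ ((⌊K * (n : ℕ)⌋₊ : ℕ∞) : ℝ≥0∞) := ENat.toENNReal_mono hopt
    _ = ENNReal.ofReal (⌊K * (n : ℕ)⌋₊ : ℝ) := by simp
    _ ≤ ENNReal.ofReal (K * (n : ℕ)) :=
      ENNReal.ofReal_le_ofReal (Nat.floor_le (by positivity))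
    _ = ENNReal.ofReal K * (n : ℕ) := by rw [ENNReal.ofReal_mul hK0, ENNReal.ofReal_natCast]

theorem exists_pmThreshold_le : ∃ C : ℝ, 0 < C ∧ ∀ k : ℕ, 2 ≤ k →
    pmThreshold k ≤ ENNReal.ofReal (1 / 2 * (1 + C * √(Real.log k / k))) := by
  -- For ε ≤ 1/100 the bound is 1/2 + 17√ε. The size of the constant comes from the remaining k,
  -- where √ε ≥ 1/10 and the fixed bound 102.1 must be at most 1/2 + 1050√ε.
  refine ⟨2100, by norm_num, fun k hk => ?_⟩
  have : NeZero k := ⟨by omega⟩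
  have hk2 : (2 : ℝ) ≤ k := by exact_mod_cast hk
  have hlog : 0.69 ≤ Real.log k :=
    le_trans (by linarith [Real.log_two_gt_d9]) (Real.log_le_log (by norm_num) hk2)
  set ε := Real.log k / k with hε
  have hε0 : 0 < ε := by positivity
  have hsq := Real.sq_sqrt hε0.le
  have hs0 : 0 < √ε := Real.sqrt_pos.2 hε0
  by_cases hsmall : ε ≤ 1 / 100
  · refine (pmThreshold_le hε0 hsmall (δ := 2 * √ε) (by positivity) ?_).trans
      (ENNReal.ofReal_le_ofReal (by linarith))
    have h1 : (1 - ε) ^ k ≤ 1 / k := by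
      calc (1 - ε) ^ k ≤ Real.exp (-ε) ^ k :=
            pow_le_pow_left₀ (by linarith) (Real.one_sub_le_exp_neg ε) k
        _ = Real.exp (-Real.log k) := by
            rw [← Real.exp_nat_mul, hε]; congr 1; field_simp
        _ = 1 / k := by rw [Real.exp_neg, Real.exp_log (by linarith), one_div]
    have h2 : 1 < √ε * k := by
      have : 1 < (√ε * k) ^ 2 := by
        rw [mul_pow, hsq, hε]
        field_simp
        nlinarith
      nlinarith [mul_pos hs0 (by linarith : (0 : ℝ) < k)]
    have h3 : (1 - 1 / (k : ℝ)) * (1 + 2 * √ε) ≤ (1 - (1 - ε) ^ k) * (1 + 2 * √ε) := by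
      gcongr
    refine lt_of_lt_of_le ?_ h3
    have h4 : (1 : ℝ) / k < √ε := by rw [div_lt_iff₀ (by linarith)]; exact h2
    have h5 : (1 : ℝ) / k ≤ 1 / 2 := one_div_le_one_div_of_le (by norm_num) hk2
    nlinarith
  · push Not at hsmall
    have h1 : 1 / 10 ≤ √ε := Real.le_sqrt_of_sq_le (by linarith)
    refine (pmThreshold_le (ε := 1 / 100) (δ := 200) (by norm_num) le_rfl (by norm_num) ?_).trans
      (ENNReal.ofReal_le_ofReal ?_)
    · have : (1 - 1 / 100 : ℝ) ^ k ≤ 1 - 1 / 100 :=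
        pow_le_of_le_one (by norm_num) (by norm_num) (by omega)
      linarith
    · have : √(1 / 100 : ℝ) ≤ 1 / 10 := by
        rw [Real.sqrt_le_left (by norm_num)]; norm_num
      linarith

/-! ### The lower bound -/

/-- Every vertex is an endpoint of some edge played, and a round has two endpoints. -/
theorem le_two_mul_length {V : Type} [Fintype V] {h : History V}
    (hp : HasPerfectMatching h.graph) : Fintype.card V ≤ 2 * h.length := by
  classical
  obtain ⟨M, hM, hs⟩ := hp
  have h1 : (Finset.univ : Finset V) ⊆ (h.map Prod.fst ++ h.map Prod.snd).toFinset := by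
    intro v _
    obtain ⟨w, hw, -⟩ := hM (hs v)
    have h2 := (M.adj_sub hw).1
    simp only [History.graph, Multiset.mem_coe, List.mem_map] at h2
    obtain ⟨e, he, h3⟩ := h2
    rw [List.mem_toFinset, List.mem_append, List.mem_map, List.mem_map]
    rcases Sym2.eq_iff.1 h3 with h4 | h4
    · exact Or.inl ⟨e, he, h4.1⟩
    · exact Or.inr ⟨e, he, h4.2⟩
  have h2 := (Finset.card_le_card h1).trans (List.toFinset_card_le _)
  rw [Finset.card_univ] at h2
  simp at h2
  omega

theorem le_optTime {k : ℕ} {V : Type} [Fintype V] [Nonempty V] {q : ℝ} (hq : 0 < q) {r : ℕ}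
    (hr : Fintype.card V = r + r) : (r : ℕ∞) ≤ optTime (V := V) HasPerfectMatching q k := by
  refine le_iInf fun S => le_iInf₂ fun t ht => ?_
  have h0 : (graphLaw S t).toOuterMeasure {G | HasPerfectMatching G} ≠ 0 :=
    fun h0 => (ENNReal.ofReal_pos.2 hq).not_ge (h0 ▸ ht)
  rw [graphLaw, PMF.toOuterMeasure_map_apply, Ne, PMF.toOuterMeasure_apply_eq_zero_iff,
    Set.not_disjoint_iff] at h0
  obtain ⟨h, hs, hp⟩ := h0
  have h1 := le_two_mul_length hp
  rw [length_of_mem_support S t h hs] at h1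
  exact_mod_cast (by omega : r ≤ t)

theorem half_le_pmThreshold (k : ℕ) : 1 / 2 ≤ pmThreshold k := by
  refine ge_of_tendsto (tendsto_limsupTime _ _ k) ?_
  filter_upwards [Ioo_mem_nhdsLT (show (0 : ℝ) < 1 by norm_num)] with q ⟨hq0, _⟩
  -- The lower bound on the upper limit needs arbitrarily large even n.
  have : (atTop ⊓ 𝓟 {n : ℕ+ | Even (n : ℕ)}).NeBot := by
    rw [← frequently_mem_iff_neBot, frequently_atTop]
    exact fun a => ⟨a + a, (PNat.lt_add_right a a).le, ⟨(a : ℕ), by simp⟩⟩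
  refine le_limsup_of_frequently_le (Eventually.frequently ?_) (by isBoundedDefault)
  rw [eventually_inf_principal]
  refine Eventually.of_forall fun n ⟨r, hr⟩ => ?_
  have h1 : (r : ℕ∞) ≤ optTime (V := Fin n) HasPerfectMatching q k :=
    le_optTime hq0 (by rw [Fintype.card_fin]; exact hr)
  rw [ENNReal.le_div_iff_mul_le (by simp) (by simp)]
  have h2 := ENat.toENNReal_mono h1
  refine le_trans ?_ h2
  rw [hr]
  push_cast
  rw [← two_mul, ← mul_assoc, one_div, ENNReal.inv_mul_cancel (by simp) (by simp), one_mul]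

end SemiRandom

/-! ### Both bounds and the limit in k -/

theorem mainTheorem7 :
    (∀ k : ℕ, 1 ≤ k → 1 / 2 ≤ SemiRandom.pmThreshold k) ∧
    (∃ C : ℝ, 0 < C ∧ ∀ k : ℕ, 2 ≤ k →
      SemiRandom.pmThreshold k ≤
        ENNReal.ofReal (1 / 2 * (1 + C * Real.sqrt (Real.log (k : ℝ) / (k : ℝ))))) ∧
    Tendsto SemiRandom.pmThreshold atTop (𝓝 (1 / 2)) := by
  refine ⟨fun k _ => SemiRandom.half_le_pmThreshold k, SemiRandom.exists_pmThreshold_le, ?_⟩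
  obtain ⟨C, -, hC⟩ := SemiRandom.exists_pmThreshold_le
  have h1 : Tendsto (fun k : ℕ => Real.log k / k) atTop (𝓝 0) :=
    (Real.isLittleO_log_id_atTop.tendsto_div_nhds_zero).comp tendsto_natCast_atTop_atTop
  have h2 : Tendsto (fun k : ℕ => 1 / 2 * (1 + C * √(Real.log k / k))) atTop (𝓝 (1 / 2)) := by
    have := ((((Real.continuous_sqrt.tendsto 0).comp h1).const_mul C).const_add 1).const_mul
      (1 / 2 : ℝ)
    rwa [Real.sqrt_zero, mul_zero, add_zero, mul_one] at this
  have h3 : Tendsto (fun k : ℕ => ENNReal.ofReal (1 / 2 * (1 + C * √(Real.log k / k)))) atTop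
      (𝓝 (1 / 2)) := by
    have e : (1 / 2 : ℝ≥0∞) = ENNReal.ofReal (1 / 2) := by
      rw [one_div, one_div, ENNReal.ofReal_inv_of_pos (by norm_num)]; simp
    rw [e]
    exact ENNReal.tendsto_ofReal h2
  refine tendsto_of_tendsto_of_tendsto_of_le_of_le' tendsto_const_nhds h3
    (Eventually.of_forall SemiRandom.half_le_pmThreshold) ?_
  filter_upwards [eventually_ge_atTop 2] with k hk using hC k hk
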